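/- All graphs are finite and simple. Let $\chi(G)$, $\omega(G)$ and $\chi_l(G)$ denote the chromatic number, the clique number and the list-chromatic number of a graph $G$. A \emph{hole} of $G$ is an induced cycle of length at least $4$; $G$ is \emph{chordal} if it has no hole; a \emph{hole cover} of $G$ is a nonempty set of vertices meeting every hole of $G$. A set $\mathcal{C}$ of vertices has the \emph{NC property} in $G$ if every hole of $G$ contains at most one vertex of $\mathcal{C}$ and, for every $u \in \mathcal{C}$, no hole containing $u$ shares two consecutive edges with a hole not containing $u$. To \emph{locally chordalize} $G$ by a vertex $u$ is to join $u$ to every other vertex that lies on a hole of $G$ containing $u$. If $\mathcal{C}$ is a hole cover of $G$ with the NC property, $\widehat{G}(\mathcal{C})$ is the graph obtained from $G$ by successive local chordalizations by the vertices of $\mathcal{C}$ (in any order). A \emph{local chordalization partition} of a hole cover $\mathcal{C}$ of $G$ is an ordered partition $(\mathcal{C}_1,\dots,\mathcal{C}_k)$ of $\mathcal{C}$ into $k \ge 1$ nonempty sets such that, for each $i=1,\dots,k$, the set $\mathcal{C}_i$ is a hole cover of $G_i$ with the NC property in $G_i$, and $G_i^*$ is chordal; here $G_0^* = G-\mathcal{C}$,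 and, for $i \ge 1$, $V(G_i)=V(G_{i-1}^*)\cup \mathcal{C}_i$, $E(G_i)=E(G_{i-1}^*)\cup E\bigl(G-\bigcup_{j=i+1}^k \mathcal{C}_j\bigr)$ and $G_i^*=\widehat{G_i}(\mathcal{C}_i)$. The \emph{non-chordality index} $i(G)$ is $0$ if $G$ is chordal, and otherwise the smallest $k$ for which some hole cover of $G$ has a local chordalization partition into $k$ sets. \textbf{Theorem.} For every positive integer $s$ and every nonnegative integer $t$ there is a complete multipartite graph $G$ with $\chi(G)=\omega(G)=s+1$, $i(G)=t$ and $\chi_l(G)=s+t+1$. In particular $\chi_l(G)=\omega(G)+i(G)$, that is, the inequality $\chi_l \le \omega + i$ holds with equality for $G$. -/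

import Mathlib

namespace NonChordality

variable {V : Type*}

/-! ### Holes and chordal graphs -/

/-- `S` is (the vertex set of) a hole of `G`: an induced cycle of length at least four.
An induced cycle is determined by its vertex set, and its edges are the edges of `G`
with both ends in `S`. -/
def IsHole (G : SimpleGraph V) (S : Set V) : Prop :=
  ∃ n : ℕ, 4 ≤ n ∧ ∃ f : SimpleGraph.cycleGraph n ↪g G, Set.range f = S

/-- A chordal graph is a graph without holes. -/
def IsChordal (G : SimpleGraph V) : Prop :=
  ∀ S : Set V, ¬ IsHole G S

/-- A hole cover of `G` is a nonempty vertex set which meets every hole of `G`. -/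
def IsHoleCover (G : SimpleGraph V) (C : Set V) : Prop :=
  C.Nonempty ∧ ∀ S : Set V, IsHole G S → (S ∩ C).Nonempty

/-- The holes `S` and `T` of `G` share two consecutive edges `ab` and `bc`. -/
def ShareConsecutiveEdges (G : SimpleGraph V) (S T : Set V) : Prop :=
  ∃ a b c : V, a ≠ c ∧ G.Adj a b ∧ G.Adj b c ∧
    a ∈ S ∩ T ∧ b ∈ S ∩ T ∧ c ∈ S ∩ T

/-- The vertex `u` has the non-consecutive property in `G`: a hole through `u` and a hole
avoiding `u` never share consecutive edges. -/
def VertexNC (G : SimpleGraph V) (u : V) : Prop :=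
  ∀ S T : Set V, IsHole G S → IsHole G T → u ∈ S → u ∉ T → ¬ ShareConsecutiveEdges G S T

/-- The vertex set `C` has the NC property in `G`: each of its vertices has the non-consecutive
property, and every hole of `G` contains at most one vertex of `C`. -/
def SetNC (G : SimpleGraph V) (C : Set V) : Prop :=
  (∀ u ∈ C, VertexNC G u) ∧ ∀ S : Set V, IsHole G S → (S ∩ C).Subsingleton

/-! ### Local chordalization -/

/-- Local chordalization by `u` of all the holes of `G` containing `u`: `u` is joined to every
other vertex lying on a hole of `G` that contains `u`. -/
def localChordalize (G : SimpleGraph V) (u : V) : SimpleGraph V :=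
  G ⊔ SimpleGraph.fromRel fun a b => a = u ∧ ∃ S : Set V, IsHole G S ∧ u ∈ S ∧ b ∈ S

/-- The graph obtained from `G` by local chordalizations, performed recursively by the vertices
of `C`. When `C` is a hole cover of `G` with the NC property, the order in which the vertices
are taken does not matter; here it is the order of the list `C.toList`. -/
noncomputable def hat (G : SimpleGraph V) (C : Finset V) : SimpleGraph V :=
  C.toList.foldl localChordalize G

/-! ### Local chordalization partitions

All graphs of a chordalization chain are written as graphs on the whole type `V`, the vertices
which are not (yet) present being isolated. Isolated vertices lie on no hole, so that holes,
chordality, hole covers, the NC property and local chordalization are not affected. -/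

/-- `G - S`, with the vertices of `S` kept as isolated vertices. -/
def del (G : SimpleGraph V) (S : Set V) : SimpleGraph V :=
  (G.induce Sᶜ).spanningCoe

/-- The edges of the graph that precedes the completion step `i`: for the graph `H` standing for
`G_{i-1}^*`, the graph `G_i` has the edge set `E(H) ∪ E(G - (P (i+1) ∪ ⋯ ∪ P k))`. -/
def extend (G H : SimpleGraph V) (P : ℕ → Finset V) (k i : ℕ) : SimpleGraph V :=
  H ⊔ del G (⋃ j ∈ Set.Icc (i + 1) k, (P j : Set V))

/-- The graphs `G_i^*` of the chordalization chain: `G_0^* = G - C`, and `G_i^*` is obtained from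
`G_i` by local chordalizations by the vertices of `P i`. -/
noncomputable def chainStar (G : SimpleGraph V) (C : Set V) (P : ℕ → Finset V) (k : ℕ) :
    ℕ → SimpleGraph V
  | 0 => del G C
  | i + 1 => hat (extend G (chainStar G C P k i) P k (i + 1)) (P (i + 1))

/-- The graphs `G_i` of the chordalization chain: `G_0 = G - C`, and for `i ≥ 1` the edge set of
`G_i` is `E(G_{i-1}^*) ∪ E(G - (P (i+1) ∪ ⋯ ∪ P k))`. -/
noncomputable def chain (G : SimpleGraph V) (C : Set V) (P : ℕ → Finset V) (k : ℕ) :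
    ℕ → SimpleGraph V
  | 0 => del G C
  | i + 1 => extend G (chainStar G C P k i) P k (i + 1)

/-- `(P 1, …, P k)` is a local chordalization partition of the hole cover `C` of `G`. The values
of `P` outside `1, …, k` play no role. -/
structure IsLocalChordalizationPartition (G : SimpleGraph V) (C : Set V) (P : ℕ → Finset V)
    (k : ℕ) : Prop where
  isHoleCover : IsHoleCover G C
  pos : 1 ≤ k
  nonempty : ∀ i ∈ Set.Icc 1 k, (P i).Nonempty
  disjoint : ∀ i ∈ Set.Icc 1 k, ∀ j ∈ Set.Icc 1 k, i ≠ j → Disjoint (P i) (P j)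
  union : ⋃ i ∈ Set.Icc 1 k, (P i : Set V) = C
  part_isHoleCover : ∀ i ∈ Set.Icc 1 k, IsHoleCover (chain G C P k i) (P i : Set V)
  part_nc : ∀ i ∈ Set.Icc 1 k, SetNC (chain G C P k i) (P i : Set V)
  star_chordal : ∀ i ∈ Set.Icc 1 k, IsChordal (chainStar G C P k i)

open Classical in
/-- The non-chordality index of `G`: zero if `G` is chordal, and otherwise the least length of a
local chordalization partition of a hole cover of `G`. -/
noncomputable def nonChordalityIndex (G : SimpleGraph V) : ℕ∞ :=
  if IsChordal G then 0
  else ⨅ (k : ℕ) (_ : ∃ (C : Set V) (P : ℕ → Finset V), IsLocalChordalizationPartition G C P k),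
    (k : ℕ∞)

/-! ### List colorings -/

/-- `G` is `k`-choosable: for every assignment of a list of `k` colors to each vertex there is a
proper coloring in which each vertex receives a color of its list. -/
def Choosable (G : SimpleGraph V) (k : ℕ) : Prop :=
  ∀ L : V → Finset ℕ, (∀ v, (L v).card = k) →
    ∃ c : V → ℕ, (∀ v, c v ∈ L v) ∧ ∀ u v, G.Adj u v → c u ≠ c v

/-- The list-chromatic number `χ_l(G)`: the least `k` such that `G` is `k`-choosable. -/
noncomputable def listChromaticNumber (G : SimpleGraph V) : ℕ∞ :=
  ⨅ (k : ℕ) (_ : Choosable G k), (k : ℕ∞)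

end NonChordality

/-!
Let `m = s + t`. The graph is the join of two pieces: a complete multipartite graph on `m`
vertices with one part of `t + 1` vertices and `s - 1` parts of a single vertex, and an independent
set of `m ^ m` vertices. It has `s + 1` parts, so `χ = ω = s + 1`.

*List-chromatic number.* With lists of `m + 1` colors, the `m` vertices of the first piece get
distinct colors by Hall's theorem (`multipartite_choosable`), and each vertex of the independent set
still has a free color. With lists of `m` colors, give the first `m` vertices disjoint lists and let
the independent set carry all transversals of these lists: whatever colors the first `m` vertices
choose, these colors form the list of a vertex that is adjacent to all of them
(`multipartite_not_choosable`). Hence `χ_l = m + 1`.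

*Upper bound on the non-chordality index.* Remove all vertices but one of the part of size `t + 1`,
and put them back one at a time. At each step all holes go through the new vertex `u`, and local
chordalization by `u` just joins it to the vertices of its part that are already present
(`chainStar_multipartite`). This is a partition into `t` singletons; for `t = 0` the graph itself is
chordal.

*Lower bound.* In a complete multipartite graph with at most two parts of more than one vertex, any
step of any local chordalization partition adds only edges incident with a single vertex
(`exists_center_hat`): if the graph `G_i` has a hole through `u ∈ P i`, then any other vertex of
`P i` in a part of at least two vertices would give a hole, of length four, with two
vertices of `P i`. So `k` vertices cover all the edges of `G_k^*` which are not edges of `G`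
(`IsLocalChordalizationPartition.exists_card_le`). As `G_k^*` is chordal, one of the two big parts
is a clique in it, and all but at most one of its vertices belong to the cover. Both parts have at
least `t + 1` vertices, so `k ≥ t`.
-/

namespace NonChordality

variable {V : Type*}

/-! ### Holes -/

/-- A vertex `u` of a hole has two neighbors `y`, `z` on the hole, not adjacent to each other, and
there is a vertex `x` of the hole not adjacent to `u`. -/
theorem exists_path_of_mem_isHole {G : SimpleGraph V} {S : Set V} (hS : IsHole G S) {u : V}
    (hu : u ∈ S) :
    ∃ x ∈ S, ∃ y ∈ S, ∃ z ∈ S, G.Adj u y ∧ G.Adj u z ∧ y ≠ z ∧ ¬ G.Adj y z ∧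
      u ≠ x ∧ ¬ G.Adj u x := by
  obtain ⟨n, hn, f, rfl⟩ := hS
  obtain ⟨i, rfl⟩ := hu
  obtain ⟨m, rfl⟩ : ∃ m, n = m + 2 + 2 := ⟨n - 4, by omega⟩
  have h1 : (1 : Fin (m + 2 + 2)).val = 1 := rfl
  have h2 : (2 : Fin (m + 2 + 2)).val = 2 := Nat.mod_eq_of_lt (show 2 < m + 2 + 2 by omega)
  have e11 : (1 + 1 : Fin (m + 2 + 2)) = 2 := by ext; simp [Fin.val_add]
  have n2 : (2 : Fin (m + 2 + 2)) ≠ 1 := fun h => by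
    have := congrArg Fin.val h
    rw [h1, h2] at this
    omega
  have n20 : (2 : Fin (m + 2 + 2)) ≠ 0 := fun h => by
    have := congrArg Fin.val h
    rw [h2, Fin.val_zero] at this
    omega
  have n3 : (-2 : Fin (m + 2 + 2)) ≠ 1 := by
    intro h
    have h' : (0 : Fin (m + 2 + 2)) = 2 + 1 := by rw [← h]; simp
    have := congrArg Fin.val h'
    rw [Fin.val_add, h1, h2, Nat.mod_eq_of_lt (by omega)] at this
    simp at this
  have d1 : i + 1 - (i - 1) = 2 := by rw [← e11]; abel
  have d2 : i - 1 - (i + 1) = -2 := by rw [← e11]; abel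
  -- `y` and `z` are the successor and the predecessor of `u`, and `x` is two steps ahead.
  refine ⟨f (i + 2), ⟨_, rfl⟩, f (i + 1), ⟨_, rfl⟩, f (i - 1), ⟨_, rfl⟩, ?_⟩
  simp only [f.map_adj_iff, SimpleGraph.cycleGraph_adj, ne_eq, f.injective.eq_iff]
  refine ⟨by simp, by simp, ?_, ?_, ?_, ?_⟩
  · intro h
    rw [h, sub_self] at d1
    exact n20 d1.symm
  · rw [d1, d2]
    exact not_or.2 ⟨n2, n3⟩
  · simpa using n20
  · simpa using ⟨n3, n2⟩

theorem isHole_of_square {G : SimpleGraph V} {a b c d : V} (hab : G.Adj a b) (hbc : G.Adj b c)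
    (hcd : G.Adj c d) (hda : G.Adj d a) (hac : a ≠ c) (hbd : b ≠ d) (nac : ¬ G.Adj a c)
    (nbd : ¬ G.Adj b d) : IsHole G {a, b, c, d} := by
  have hinj : Function.Injective ![a, b, c, d] := by
    intro i j h
    fin_cases i <;> fin_cases j <;>
      simp_all [hab.ne, hbc.ne, hcd.ne, hda.ne, hab.ne', hbc.ne', hcd.ne', hda.ne', hac.symm,
        hbd.symm]
  refine ⟨4, le_rfl, ⟨⟨![a, b, c, d], hinj⟩, ?_⟩, ?_⟩
  · intro i j
    have nca : ¬ G.Adj c a := fun h => nac h.symm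
    have ndb : ¬ G.Adj d b := fun h => nbd h.symm
    fin_cases i <;> fin_cases j <;>
      simp [SimpleGraph.cycleGraph_adj, hab, hbc, hcd, hda, hab.symm, hbc.symm, hcd.symm,
        hda.symm, nac, nbd, nca, ndb] <;> decide
  · ext v
    simp [Matrix.range_cons]
    tauto

/-! ### Local chordalization -/

theorem localChordalize_adj {G : SimpleGraph V} {u a b : V} :
    (localChordalize G u).Adj a b ↔ G.Adj a b ∨ a ≠ b ∧
      ((a = u ∧ ∃ S, IsHole G S ∧ u ∈ S ∧ b ∈ S) ∨
        (b = u ∧ ∃ S, IsHole G S ∧ u ∈ S ∧ a ∈ S)) := by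
  simp [localChordalize]

theorem del_adj {G : SimpleGraph V} {S : Set V} {a b : V} :
    (del G S).Adj a b ↔ G.Adj a b ∧ a ∉ S ∧ b ∉ S := by
  simp [del]

/-- Isolated vertices stay isolated in a local chordalization, as they lie on no hole. -/
theorem localChordalize_support {F : SimpleGraph V} {D : Set V}
    (hD : ∀ a b, F.Adj a b → a ∉ D) (u : V) :
    ∀ a b, (localChordalize F u).Adj a b → a ∉ D := by
  have key : ∀ S, IsHole F S → ∀ a ∈ S, a ∉ D := fun S hS a ha => by
    obtain ⟨-, -, y, -, -, -, h, -⟩ := exists_path_of_mem_isHole hS ha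
    exact hD _ _ h
  intro a b h
  rcases localChordalize_adj.1 h with h | ⟨-, ⟨rfl, S, hS, ha, -⟩ | ⟨-, S, hS, -, ha⟩⟩
  · exact hD _ _ h
  · exact key S hS _ ha
  · exact key S hS _ ha

theorem le_hat (F : SimpleGraph V) (C : Finset V) : F ≤ hat F C :=
  List.foldlRecOn (motive := fun F' => F ≤ F') _ _ le_rfl
    fun _ h _ _ => h.trans le_sup_left

theorem hat_support {F : SimpleGraph V} {D : Set V} (hD : ∀ a b, F.Adj a b → a ∉ D)
    (C : Finset V) : ∀ a b, (hat F C).Adj a b → a ∉ D :=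
  List.foldlRecOn (motive := fun F' : SimpleGraph V => ∀ a b, F'.Adj a b → a ∉ D) _ _ hD
    fun _ h u _ => localChordalize_support h u

theorem hat_eq_self_of_isChordal {F : SimpleGraph V} (hF : IsChordal F) (C : Finset V) :
    hat F C = F := by
  refine List.foldlRecOn (motive := fun F' : SimpleGraph V => F' = F) _ _ rfl ?_
  rintro _ rfl u -
  ext a b
  rw [localChordalize_adj]
  simp [hF _]

/-! ### Length of local chordalization partitions of complete multipartite graphs -/

/-- For a complete multipartite graph: at most two parts have more than one vertex. Each of the
pairs `u, u'`, `y, y'` and `v, v'` witnesses that the part of its first vertex has at least two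
vertices; if `u` and `y` are in different parts, then `v` is in the part of `u` or in the part of
`y`. -/
def AtMostTwoBigParts (G : SimpleGraph V) : Prop :=
  ∀ u u' y y' v v' : V, u ≠ u' → ¬ G.Adj u u' → y ≠ y' → ¬ G.Adj y y' → v ≠ v' → ¬ G.Adj v v' →
    G.Adj u y → ¬ G.Adj u v ∨ ¬ G.Adj y v

/-- One step of a local chordalization partition of `G`, where `F` is the graph before the
completion, `C` the set of the step, and `D` the set of vertices not yet present. All edges added
by the completion share a vertex. -/
theorem exists_center_hat {G F : SimpleGraph V} {C : Finset V} {D : Set V}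
    (hG : G.IsCompleteMultipartite) (h2 : AtMostTwoBigParts G)
    (hDF : del G D ≤ F) (hsupp : ∀ a b, F.Adj a b → a ∉ D) (hCD : ∀ v ∈ C, v ∉ D)
    (hC : ∀ v ∈ C, ∀ b, F.Adj v b → G.Adj v b)
    (hcov : IsHoleCover F C) (hnc : SetNC F C) :
    ∃ u, ∀ a b, (hat F C).Adj a b → F.Adj a b ∨ a = u ∨ b = u := by
  by_cases hF : IsChordal F
  · obtain ⟨u, -⟩ := hcov.1
    exact ⟨u, fun a b h => Or.inl (by rwa [hat_eq_self_of_isChordal hF] at h)⟩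
  obtain ⟨S, hS⟩ : ∃ S, IsHole F S := by simpa [IsChordal] using hF
  obtain ⟨u, huS, huC⟩ := hcov.2 S hS
  rw [Finset.mem_coe] at huC
  have hmem : ∀ a ∈ S, a ∉ D := fun a ha => by
    obtain ⟨-, -, y, -, -, -, h, -⟩ := exists_path_of_mem_isHole hS ha
    exact hsupp _ _ h
  have hadj : ∀ {a b}, a ∉ D → b ∉ D → G.Adj a b → F.Adj a b := fun ha hb h =>
    hDF (del_adj.2 ⟨h, ha, hb⟩)
  obtain ⟨x, hxS, y, hyS, z, hzS, huy, huz, hyz, nyz, hux, nux⟩ :=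
    exists_path_of_mem_isHole hS huS
  have hu := hmem u huS
  have hx := hmem x hxS
  have hy := hmem y hyS
  have hz := hmem z hzS
  have nux' : ¬ G.Adj u x := fun h => nux (hadj hu hx h)
  have nyz' : ¬ G.Adj y z := fun h => nyz (hadj hy hz h)
  have huy' := hC u huC y huy
  have huz' := hC u huC z huz
  -- Adjacency in `G` is unchanged when an endpoint is replaced by a vertex of the same part.
  have repl : ∀ {a b c}, ¬ G.Adj a b → G.Adj a c → G.Adj b c := fun {a b c} hab hac => by
    by_contra hbc
    exact hG.trans _ _ _ hab hbc hac
  have hone : ∀ T, IsHole F T → u ∈ T → ∀ v ∈ C, v ∈ T → v = u := fun T hT huT v hv hvT =>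
    hnc.2 T hT ⟨hvT, hv⟩ ⟨huT, huC⟩
  -- The other vertices of `C` form parts of their own, hence are joined to all vertices present:
  -- local chordalization by them adds no edge.
  have dom : ∀ v ∈ C, v ≠ u → ∀ w, v ≠ w → G.Adj v w := by
    intro v hv hvu w hvw
    by_contra nvw
    have hvD := hCD v hv
    have nu : ∀ {b}, ¬ G.Adj u b → ¬ F.Adj u b := fun h h' => h (hC u huC _ h')
    have nv : ∀ {b}, ¬ G.Adj v b → ¬ F.Adj v b := fun h h' => h (hC v hv _ h')
    rcases h2 u x y z v w hux nux' hyz nyz' hvw nvw huy' with nuv | nyv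
    · -- `v` is in the part of `u`: the square `u y v z` has two vertices in `C`.
      refine hvu (hone {u, y, v, z} ?_ (by simp) v hv (by simp))
      have hvy := hadj hvD hy (repl nuv huy')
      have hvz := hadj hvD hz (repl nuv huz')
      exact isHole_of_square huy hvy.symm hvz huz.symm hvu.symm hyz (nu nuv) nyz
    · -- `v` is in the part of `y` and `z`: a square through `u`, `x` and `v` has two vertices in
      -- `C`.
      have huv := (repl nyv huy'.symm).symm
      have hxv := repl nux' huv
      obtain ⟨y', hy', hvy', nvy', huy''⟩ :
          ∃ y', y' ∉ D ∧ v ≠ y' ∧ ¬ G.Adj v y' ∧ G.Adj u y' := by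
        by_cases hvy : v = y
        · exact ⟨z, hz, hvy ▸ hyz, hvy ▸ nyz', huz'⟩
        · exact ⟨y, hy, hvy, fun h => nyv h.symm, huy'⟩
      refine hvu (hone {u, v, x, y'} ?_ (by simp) v hv (by simp))
      exact isHole_of_square (hadj hu hvD huv) (hadj hx hvD hxv).symm
        (hadj hx hy' (repl nux' huy'')) (hadj hu hy' huy'').symm hux hvy' nux (nv nvy')
  refine ⟨u, ?_⟩
  have main : F ≤ hat F C ∧ (∀ a b, (hat F C).Adj a b → a ∉ D) ∧
      ∀ a b, (hat F C).Adj a b → F.Adj a b ∨ a = u ∨ b = u := by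
    refine List.foldlRecOn (motive := fun F' : SimpleGraph V => F ≤ F' ∧
      (∀ a b, F'.Adj a b → a ∉ D) ∧ ∀ a b, F'.Adj a b → F.Adj a b ∨ a = u ∨ b = u) _ _
      ⟨le_rfl, hsupp, fun a b h => Or.inl h⟩ ?_
    rintro F' ⟨hle, hsupp', hnew⟩ v hv
    rw [Finset.mem_toList] at hv
    have hsupp'' := localChordalize_support hsupp' v
    refine ⟨hle.trans le_sup_left, hsupp'', fun a b h => ?_⟩
    have ha := hsupp'' _ _ h
    have hb := hsupp'' _ _ h.symm
    rcases localChordalize_adj.1 h with h' | ⟨hab, ⟨rfl, -⟩ | ⟨rfl, -⟩⟩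
    · exact hnew _ _ h'
    · by_cases hau : a = u
      · exact Or.inr (Or.inl hau)
      · exact Or.inl (hadj ha hb (dom a hv hau b hab))
    · by_cases hbu : b = u
      · exact Or.inr (Or.inr hbu)
      · exact Or.inl (hadj ha hb (dom b hv hbu a hab.symm).symm)
  exact main.2.2

/-- The graph `G_i^*` contains all edges of `G` between the vertices present, its other vertices
are isolated, and some `i` vertices cover all its edges that are not edges of `G`. -/
theorem IsLocalChordalizationPartition.exists_card_le {G : SimpleGraph V} {C : Set V}
    {P : ℕ → Finset V} {k : ℕ} (hP : IsLocalChordalizationPartition G C P k)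
    (hG : G.IsCompleteMultipartite) (h2 : AtMostTwoBigParts G) {i : ℕ} (hi : i ≤ k) :
    del G (⋃ j ∈ Set.Icc (i + 1) k, (P j : Set V)) ≤ chainStar G C P k i ∧
    (∀ a b, (chainStar G C P k i).Adj a b → a ∉ ⋃ j ∈ Set.Icc (i + 1) k, (P j : Set V)) ∧
    ∃ R : Finset V, R.card ≤ i ∧
      ∀ a b, (chainStar G C P k i).Adj a b → G.Adj a b ∨ a ∈ R ∨ b ∈ R := by
  classical
  induction i with
  | zero =>
    have hU : ⋃ j ∈ Set.Icc (0 + 1) k, (P j : Set V) = C := hP.union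
    rw [hU]
    exact ⟨le_rfl, fun a b h => (del_adj.1 h).2.1, ∅, le_rfl,
      fun a b h => Or.inl (del_adj.1 h).1⟩
  | succ i ih =>
    obtain ⟨-, hsupp, R, hR, hRadj⟩ := ih (by omega)
    have hI : i + 1 ∈ Set.Icc 1 k := ⟨by omega, hi⟩
    set D := ⋃ j ∈ Set.Icc (i + 1) k, (P j : Set V) with hD
    set D' := ⋃ j ∈ Set.Icc (i + 1 + 1) k, (P j : Set V) with hD'
    have hDD : D' ⊆ D := Set.biUnion_subset_biUnion_left (Set.Icc_subset_Icc_left (by omega))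
    have hPD : ∀ v ∈ P (i + 1), v ∈ D := fun v hv =>
      Set.mem_biUnion (show i + 1 ∈ Set.Icc (i + 1) k from ⟨le_rfl, hi⟩) hv
    have hPD' : ∀ v ∈ P (i + 1), v ∉ D' := fun v hv hvD => by
      obtain ⟨j, hj, hvj⟩ := Set.mem_iUnion₂.1 hvD
      have hj1 : i + 1 + 1 ≤ j := hj.1
      exact Finset.disjoint_left.1 (hP.disjoint _ hI j ⟨by omega, hj.2⟩ (by omega)) hv hvj
    have hF : chain G C P k (i + 1) = chainStar G C P k i ⊔ del G D' := rfl
    have hle : del G D' ≤ chain G C P k (i + 1) := hF ▸ le_sup_right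
    have hsupp' : ∀ a b, (chain G C P k (i + 1)).Adj a b → a ∉ D' := by
      rintro a b (h | h)
      · exact fun ha => hsupp _ _ h (hDD ha)
      · exact (del_adj.1 h).2.1
    have hstar : chainStar G C P k (i + 1) = hat (chain G C P k (i + 1)) (P (i + 1)) := rfl
    obtain ⟨u, hu⟩ := exists_center_hat hG h2 hle hsupp' hPD'
      (by
        rintro v hv b (h | h)
        · exact absurd (hPD v hv) (hsupp _ _ h)
        · exact (del_adj.1 h).1)
      (hP.part_isHoleCover _ hI) (hP.part_nc _ hI)
    rw [hstar]
    refine ⟨hle.trans (le_hat _ _), hat_support hsupp' _, insert u R,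
      (Finset.card_insert_le _ _).trans (by omega), fun a b h => ?_⟩
    simp only [Finset.mem_insert]
    rcases hu a b h with (h | h) | h | h
    · have := hRadj a b h
      tauto
    · exact Or.inl (del_adj.1 h).1
    · tauto
    · tauto

/-- A local chordalization partition has length at least `t` if `G` has two disjoint independent
sets `A` and `B`, completely joined to each other, of more than `t` vertices each. -/
theorem IsLocalChordalizationPartition.le_length {G : SimpleGraph V} {C : Set V}
    {P : ℕ → Finset V} {k : ℕ} (hP : IsLocalChordalizationPartition G C P k)
    (hG : G.IsCompleteMultipartite) (h2 : AtMostTwoBigParts G) {A B : Finset V}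
    (hA : ∀ a ∈ A, ∀ a' ∈ A, ¬ G.Adj a a') (hB : ∀ b ∈ B, ∀ b' ∈ B, ¬ G.Adj b b')
    (hAB : ∀ a ∈ A, ∀ b ∈ B, G.Adj a b) {t : ℕ} (hAt : t + 1 ≤ A.card) (hBt : t + 1 ≤ B.card) :
    t ≤ k := by
  classical
  obtain ⟨hle, -, R, hR, hRadj⟩ := hP.exists_card_le hG h2 le_rfl
  have hle : G ≤ chainStar G C P k k := fun a b h => hle (del_adj.2 ⟨h, by simp, by simp⟩)
  -- If an independent set `I` of `G` has become a clique, then at most one of its vertices is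
  -- outside `R`.
  have key : ∀ I : Finset V, (∀ a ∈ I, ∀ a' ∈ I, ¬ G.Adj a a') → t + 1 ≤ I.card →
      (∀ a ∈ I, ∀ a' ∈ I, a ≠ a' → (chainStar G C P k k).Adj a a') → t ≤ k := by
    intro I hI hIt hcl
    have h1 : (I \ R).card ≤ 1 := by
      refine Finset.card_le_one.2 fun a ha b hb => ?_
      rw [Finset.mem_sdiff] at ha hb
      by_contra hab
      rcases hRadj a b (hcl a ha.1 b hb.1 hab) with h | h | h
      · exact hI a ha.1 b hb.1 h
      · exact ha.2 h
      · exact hb.2 h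
    have := Finset.le_card_sdiff R I
    omega
  by_cases hA' : ∀ a ∈ A, ∀ a' ∈ A, a ≠ a' → (chainStar G C P k k).Adj a a'
  · exact key A hA hAt hA'
  by_cases hB' : ∀ a ∈ B, ∀ a' ∈ B, a ≠ a' → (chainStar G C P k k).Adj a a'
  · exact key B hB hBt hB'
  push Not at hA' hB'
  obtain ⟨a, ha, a', ha', haa, naa⟩ := hA'
  obtain ⟨b, hb, b', hb', hbb, nbb⟩ := hB'
  exact absurd (isHole_of_square (hle (hAB a ha b hb)) (hle (hAB a' ha' b hb)).symm
    (hle (hAB a' ha' b' hb')) (hle (hAB a ha b' hb')).symm haa hbb naa nbb)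
    (hP.star_chordal k ⟨hP.pos, le_rfl⟩ _)

/-! ### The multipartite graph and its colorings -/

theorem Choosable.mono {G : SimpleGraph V} {k l : ℕ} (h : Choosable G k) (hkl : k ≤ l) :
    Choosable G l := by
  intro L hL
  choose L' hL' hcard using fun v => Finset.exists_subset_card_eq (hkl.trans (hL v).ge)
  obtain ⟨c, hc, hadj⟩ := h L' hcard
  exact ⟨c, fun v => hL' v (hc v), hadj⟩

/-- The vertices: `m` of them numbered by `Fin m`, and one for each function `Fin m → Fin m`, that
is, for each transversal of `m` disjoint lists of `m` colors. -/
abbrev Vert (m : ℕ) : Type := Fin m ⊕ (Fin m → Fin m)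

/-- The number of a vertex of the first kind, and `m` for all vertices of the second kind. -/
def rank {m : ℕ} : Vert m → ℕ := Sum.elim (fun j => j) (fun _ => m)

/-- The complete multipartite graph in which the part of `v` is the truncated difference `rank v -
t`: the vertices of rank at most `t` form one part, those of rank `m` another, and all others are
parts by themselves. -/
def multipartite (m t : ℕ) : SimpleGraph (Vert m) :=
  (⊤ : SimpleGraph ℕ).comap fun v => rank v - t

section
variable {m t : ℕ}

@[simp] theorem rank_inl (j : Fin m) : rank (Sum.inl j : Vert m) = j := rfl

@[simp] theorem rank_inr (φ : Fin m → Fin m) : rank (Sum.inr φ : Vert m) = m := rfl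

@[simp] theorem multipartite_adj {a b : Vert m} :
    (multipartite m t).Adj a b ↔ rank a - t ≠ rank b - t := Iff.rfl

theorem rank_le (v : Vert m) : rank v ≤ m := by
  rcases v with j | φ
  · exact j.2.le
  · exact le_rfl

theorem rank_eq_of_ne {a b : Vert m} (hab : a ≠ b) (h : rank a = rank b) : rank a = m := by
  rcases a with i | φ <;> rcases b with j | ψ
  · exact absurd (congrArg Sum.inl (Fin.ext h)) hab
  · exact h
  · rfl
  · rfl

theorem exists_rank_eq (hm : 0 < m) {r : ℕ} (hr : r ≤ m) : ∃ v : Vert m, rank v = r := by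
  rcases hr.lt_or_eq with h | rfl
  · exact ⟨Sum.inl ⟨r, h⟩, rfl⟩
  · exact ⟨Sum.inr id, rfl⟩

theorem exists_ne_rank_eq (hm : 2 ≤ m) : ∃ v w : Vert m, v ≠ w ∧ rank v = m ∧ rank w = m :=
  ⟨Sum.inr fun _ => ⟨0, by omega⟩, Sum.inr fun _ => ⟨1, by omega⟩, by
    intro h
    simpa using congrFun (Sum.inr.inj h) ⟨0, by omega⟩, rfl, rfl⟩

theorem multipartite_isCompleteMultipartite : (multipartite m t).IsCompleteMultipartite := by
  refine ⟨fun a b c hab hbc => ?_⟩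
  simp only [multipartite_adj, ne_eq, not_not] at *
  exact hab.trans hbc

theorem rank_of_not_adj {a b : Vert m} (hab : a ≠ b) (h : ¬ (multipartite m t).Adj a b) :
    rank a ≤ t ∧ rank b ≤ t ∨ rank a = m ∧ rank b = m := by
  simp only [multipartite_adj, ne_eq, not_not] at h
  by_cases hr : rank a = rank b
  · have := rank_eq_of_ne hab hr
    omega
  · omega

theorem multipartite_atMostTwoBigParts : AtMostTwoBigParts (multipartite m t) := by
  intro u u' y y' v v' hu nu hy ny hv nv huy
  have := rank_of_not_adj hu nu
  have := rank_of_not_adj hy ny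
  have := rank_of_not_adj hv nv
  simp only [multipartite_adj] at *
  omega

theorem multipartite_chromaticNumber_cliqueNum (h : t < m) :
    (multipartite m t).chromaticNumber = ((m - t + 1 : ℕ) : ℕ∞) ∧
      (multipartite m t).cliqueNum = m - t + 1 := by
  classical
  have hcol : (multipartite m t).Colorable (m - t + 1) :=
    ⟨SimpleGraph.Coloring.mk (fun v => ⟨rank v - t, by have := rank_le v; omega⟩)
      (fun {a b} hab heq => hab (Fin.mk.inj heq))⟩
  -- A clique with one vertex from each part: ranks `t, t + 1, …, m`.
  choose g hg using fun j : Fin (m - t + 1) =>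
    exists_rank_eq (m := m) (by omega) (r := j + t) (by omega)
  have hinj : Function.Injective g := fun i j hij => by
    have := congrArg rank hij
    rw [hg, hg] at this
    exact Fin.ext (by omega)
  have hcl : (multipartite m t).IsNClique (m - t + 1) (Finset.univ.image g) := by
    refine ⟨?_, by simp [Finset.card_image_of_injective _ hinj]⟩
    intro a ha b hb hab
    simp only [Finset.coe_image, Finset.coe_univ, Set.image_univ, Set.mem_range] at ha hb
    obtain ⟨i, rfl⟩ := ha
    obtain ⟨j, rfl⟩ := hb
    rw [multipartite_adj, hg, hg]
    intro h
    exact hab (congrArg g (Fin.ext (by omega)))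
  have h1 := hcol.chromaticNumber_le
  have h2 := hcl.2 ▸ hcl.1.card_le_cliqueNum
  have h3 := (multipartite m t).cliqueNum_le_chromaticNumber
  refine ⟨le_antisymm h1 (le_trans (by exact_mod_cast h2) h3), le_antisymm ?_ h2⟩
  exact_mod_cast h3.trans h1

theorem multipartite_choosable : Choosable (multipartite m t) (m + 1) := by
  classical
  intro L hL
  obtain ⟨f, hf, hfL⟩ := (Finset.all_card_le_biUnion_card_iff_exists_injective
    fun j : Fin m => L (Sum.inl j)).1 fun T => by
      rcases T.eq_empty_or_nonempty with rfl | ⟨j, hj⟩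
      · simp
      · calc T.card ≤ m := by simpa using T.card_le_univ
          _ ≤ (L (Sum.inl j)).card := by rw [hL]; omega
          _ ≤ _ := Finset.card_le_card (Finset.subset_biUnion_of_mem (fun j => L (Sum.inl j)) hj)
  have hex : ∀ φ : Fin m → Fin m, ∃ c ∈ L (Sum.inr φ), c ∉ Finset.univ.image f := fun φ =>
    Finset.exists_mem_notMem_of_card_lt_card <| by
      rw [hL, Finset.card_image_of_injective _ hf]
      simp
  choose g hgL hg using hex
  refine ⟨Sum.elim f g, ?_, ?_⟩
  · rintro (j | φ)
    · exact hfL j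
    · exact hgL φ
  · rintro (i | φ) (j | ψ) hadj
    · intro h
      exact hadj (by rw [hf h])
    · exact fun h => hg ψ (Finset.mem_image.2 ⟨i, Finset.mem_univ i, h⟩)
    · exact fun h => hg φ (Finset.mem_image.2 ⟨j, Finset.mem_univ j, h.symm⟩)
    · exact absurd rfl hadj

theorem multipartite_not_choosable (h : t < m) : ¬ Choosable (multipartite m t) m := by
  intro hch
  obtain ⟨c, hc, hadj⟩ := hch
    (Sum.elim (fun j => Finset.univ.image fun r : Fin m => Nat.pair j r)
      (fun φ => Finset.univ.image fun j : Fin m => Nat.pair j (φ j))) (by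
      rintro (j | φ)
      · rw [Sum.elim_inl, Finset.card_image_of_injective, Finset.card_univ, Fintype.card_fin]
        intro r r' h
        exact Fin.ext (Nat.pair_eq_pair.1 h).2
      · rw [Sum.elim_inr, Finset.card_image_of_injective, Finset.card_univ, Fintype.card_fin]
        intro r r' h
        exact Fin.ext (Nat.pair_eq_pair.1 h).1)
  have h1 : ∀ j : Fin m, ∃ r : Fin m, Nat.pair j r = c (Sum.inl j) := fun j => by
    simpa using hc (Sum.inl j)
  -- `φ` is the transversal formed by the colors of the first `m` vertices.
  choose φ hφ using h1
  obtain ⟨j, hj⟩ : ∃ j : Fin m, Nat.pair j (φ j) = c (Sum.inr φ) := by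
    simpa using hc (Sum.inr φ)
  refine hadj (Sum.inl j) (Sum.inr φ) ?_ ((hφ j).symm.trans hj)
  have := j.2
  simp only [multipartite_adj, rank_inl, rank_inr]
  omega

theorem multipartite_listChromaticNumber (h : t < m) :
    listChromaticNumber (multipartite m t) = ((m + 1 : ℕ) : ℕ∞) := by
  refine le_antisymm (iInf₂_le _ multipartite_choosable) (le_iInf₂ fun k hk => ?_)
  by_contra hlt
  rw [not_le, Nat.cast_lt] at hlt
  exact multipartite_not_choosable h (hk.mono (by omega))

/-! ### Non-chordality index of the multipartite graph -/

theorem multipartite_isChordal (m : ℕ) : IsChordal (multipartite m 0) := by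
  intro S hS
  obtain ⟨n, hn, f, rfl⟩ := id hS
  obtain ⟨x, -, y, hy, z, -, huy, -, -, -, hux, nux⟩ :=
    exists_path_of_mem_isHole hS (Set.mem_range_self ⟨0, by omega⟩)
  obtain ⟨x', -, y', -, z', -, -, -, -, -, hyx, nyx⟩ := exists_path_of_mem_isHole hS hy
  simp only [multipartite_adj] at *
  have := rank_eq_of_ne hux (by omega)
  have := rank_eq_of_ne hyx (by omega)
  omega

/-- The vertices of rank `i + 1, …, t`, that is, those of the part of size `t + 1` which are
missing after `i` steps; for `i = 0` it is the hole cover that is partitioned. -/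
def laterPart (m t i : ℕ) : Set (Vert m) := {v | i < rank v ∧ rank v ≤ t}

/-- The graph `G_i^*` of the partition into singletons: the vertices of `laterPart m t i` are
isolated, and the rest of the part of rank at most `t` has become a clique. -/
def completed (m t i : ℕ) : SimpleGraph (Vert m) where
  Adj a b := a ≠ b ∧ a ∉ laterPart m t i ∧ b ∉ laterPart m t i ∧
    (rank a - t ≠ rank b - t ∨ rank a ≤ t)
  symm := ⟨fun a b h => ⟨h.1.symm, h.2.2.1, h.2.1, by have := h.2.2.2; omega⟩⟩
  loopless := ⟨fun a h => h.1 rfl⟩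

theorem completed_adj {i : ℕ} {a b : Vert m} :
    (completed m t i).Adj a b ↔ a ≠ b ∧ ¬ (i < rank a ∧ rank a ≤ t) ∧
      ¬ (i < rank b ∧ rank b ≤ t) ∧ (rank a - t ≠ rank b - t ∨ rank a ≤ t) := Iff.rfl

/-- Two vertices of `completed m t i` that are not isolated and not adjacent have rank `m`, so that
a hole would consist of pairwise nonadjacent vertices. -/
theorem completed_isChordal (h : t < m) (i : ℕ) : IsChordal (completed m t i) := by
  intro S hS
  have key : ∀ u ∈ S, rank u = m := fun u hu => by
    obtain ⟨x, hx, y, -, z, -, huy, -, -, -, hux, nux⟩ := exists_path_of_mem_isHole hS hu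
    obtain ⟨-, -, y', -, -, -, hxy, -⟩ := exists_path_of_mem_isHole hS hx
    rw [completed_adj] at *
    by_contra hne
    have : rank u ≠ rank x := fun h => hne (rank_eq_of_ne hux h)
    simp only [ne_eq, hux, not_false_eq_true, true_and] at nux
    omega
  obtain ⟨n, hn, f, rfl⟩ := id hS
  have hu : f ⟨0, by omega⟩ ∈ Set.range f := Set.mem_range_self _
  obtain ⟨x, -, y, hy, z, -, huy, -⟩ := exists_path_of_mem_isHole hS hu
  have := key _ hu
  have := key _ hy
  rw [completed_adj] at huy
  omega

/-- The vertex put back at step `i`, as a singleton (empty for `i ≥ m`, which does not occur). -/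
def stepPart (m i : ℕ) : Finset (Vert m) :=
  if h : i < m then {Sum.inl ⟨i, h⟩} else ∅

theorem stepPart_eq {i : ℕ} (h : i < m) : stepPart m i = {Sum.inl ⟨i, h⟩} := dif_pos h

theorem mem_stepPart {i : ℕ} (h : i < m) {v : Vert m} : v ∈ stepPart m i ↔ rank v = i := by
  rw [stepPart_eq h, Finset.mem_singleton]
  constructor
  · rintro rfl
    rfl
  · intro hv
    by_contra hne
    have := rank_eq_of_ne hne hv
    omega

theorem iUnion_stepPart (h : t < m) (i : ℕ) :
    ⋃ j ∈ Set.Icc (i + 1) t, (stepPart m j : Set (Vert m)) = laterPart m t i := by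
  ext v
  simp only [Set.mem_iUnion, Finset.mem_coe, laterPart, Set.mem_ofPred_eq, exists_prop, Set.mem_Icc]
  constructor
  · rintro ⟨j, hj, hv⟩
    rw [mem_stepPart (by omega)] at hv
    omega
  · intro hv
    exact ⟨rank v, by omega, (mem_stepPart (by omega)).2 rfl⟩

theorem chain_multipartite_adj (h : t < m) {i : ℕ}
    (ih : chainStar (multipartite m t) (laterPart m t 0) (stepPart m) t i = completed m t i)
    {a b : Vert m} :
    (chain (multipartite m t) (laterPart m t 0) (stepPart m) t (i + 1)).Adj a b ↔
      (completed m t i).Adj a b ∨ rank a - t ≠ rank b - t ∧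
        ¬ (i + 1 < rank a ∧ rank a ≤ t) ∧ ¬ (i + 1 < rank b ∧ rank b ≤ t) := by
  rw [chain, extend, ih, iUnion_stepPart h, SimpleGraph.sup_adj, del_adj]
  rfl

/-- Every hole of `G_{i+1}` contains the new vertex, because away from it `G_{i+1}` agrees with the
chordal graph `G_i^*`. -/
theorem mem_of_isHole_chain (h : t < m) {i : ℕ}
    (ih : chainStar (multipartite m t) (laterPart m t 0) (stepPart m) t i = completed m t i)
    {S : Set (Vert m)}
    (hS : IsHole (chain (multipartite m t) (laterPart m t 0) (stepPart m) t (i + 1)) S) :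
    ∃ u ∈ S, rank u = i + 1 := by
  by_contra! hno
  obtain ⟨n, hn, f, rfl⟩ := hS
  refine completed_isChordal h i (Set.range f) ⟨n, hn, ⟨f.toEmbedding, fun {a b} => ?_⟩, rfl⟩
  rw [← f.map_adj_iff (v := a) (w := b), chain_multipartite_adj h ih]
  have ha := hno (f a) ⟨a, rfl⟩
  have hb := hno (f b) ⟨b, rfl⟩
  refine ⟨Or.inl, fun h' => h'.elim id fun h' => ?_⟩
  have hab : f a ≠ f b := fun hab => h'.1 (congrArg (fun v => rank v - t) hab)
  have : ¬ (i < rank (f a) ∧ rank (f a) ≤ t) ∧ ¬ (i < rank (f b) ∧ rank (f b) ≤ t) := by omega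
  exact completed_adj.2 ⟨hab, this.1, this.2, Or.inl h'.1⟩

theorem chainStar_multipartite (h : t < m) {i : ℕ} (hi : i ≤ t) :
    chainStar (multipartite m t) (laterPart m t 0) (stepPart m) t i = completed m t i := by
  induction i with
  | zero =>
    ext a b
    rw [chainStar, del_adj, completed_adj, multipartite_adj]
    simp only [laterPart, Set.mem_ofPred_eq]
    refine ⟨fun ⟨h1, h2, h3⟩ => ⟨fun hab => h1 (by rw [hab]), h2, h3, Or.inl h1⟩,
      fun ⟨h1, h2, h3, h4⟩ => ⟨?_, h2, h3⟩⟩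
    have : rank a ≠ rank b := fun hr => by
      have := rank_eq_of_ne h1 hr
      omega
    omega
  | succ i ih =>
    have ih := ih (by omega)
    have him : i + 1 < m := by omega
    have hstar : chainStar (multipartite m t) (laterPart m t 0) (stepPart m) t (i + 1) =
        localChordalize (chain (multipartite m t) (laterPart m t 0) (stepPart m) t (i + 1))
          (Sum.inl ⟨i + 1, him⟩) := by
      rw [chainStar, hat, stepPart_eq him, Finset.toList_singleton]
      rfl
    rw [hstar]
    set u : Vert m := Sum.inl ⟨i + 1, him⟩ with hu
    have hru : rank u = i + 1 := rfl
    set F := chain (multipartite m t) (laterPart m t 0) (stepPart m) t (i + 1) with hF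
    have hFadj : ∀ a b, F.Adj a b ↔ _ := fun a b => chain_multipartite_adj h ih
    have huniq : ∀ v, rank v = i + 1 → v = u := fun v hv => by
      by_contra hne
      have := rank_eq_of_ne hne hv
      omega
    -- `u` lies on a square with each vertex that precedes it in its part.
    have hhole : ∀ b, rank b ≤ i → ∃ S, IsHole F S ∧ u ∈ S ∧ b ∈ S := by
      intro b hb
      obtain ⟨v, w, hvw, hv, hw⟩ := exists_ne_rank_eq (m := m) (by omega)
      have hub : u ≠ b := fun h => by rw [← h] at hb; omega
      refine ⟨{u, v, b, w}, isHole_of_square ?_ ?_ ?_ ?_ hub hvw ?_ ?_, by simp, by simp⟩ <;>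
        rw [hFadj, completed_adj] <;> omega
    have hFle : ∀ a b, F.Adj a b → (completed m t (i + 1)).Adj a b := by
      intro a b hab
      refine completed_adj.2 ⟨hab.ne, ?_⟩
      rw [hFadj, completed_adj] at hab
      omega
    have hmem : ∀ S, IsHole F S → ∀ b ∈ S, ¬ (i + 1 < rank b ∧ rank b ≤ t) := by
      intro S hS b hb
      obtain ⟨-, -, y, -, -, -, hby, -⟩ := exists_path_of_mem_isHole hS hb
      exact (completed_adj.1 (hFle _ _ hby)).2.1
    ext a b
    rw [localChordalize_adj]
    constructor
    · rintro (hab | ⟨hab, ⟨rfl, S, hS, -, hb⟩ | ⟨rfl, S, hS, -, ha⟩⟩)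
      · exact hFle _ _ hab
      · exact completed_adj.2 ⟨hab, by omega, hmem S hS b hb, by omega⟩
      · exact completed_adj.2 ⟨hab, hmem S hS a ha, by omega, by omega⟩
    · intro hab
      rw [completed_adj] at hab
      obtain ⟨hne, ha, hb, hor⟩ := hab
      by_cases hp : rank a - t = rank b - t
      · by_cases hau : rank a = i + 1
        · obtain rfl := huniq a hau
          have : rank b ≠ i + 1 := fun hb' => hne (huniq b hb').symm
          exact Or.inr ⟨hne, Or.inl ⟨rfl, hhole b (by omega)⟩⟩
        · by_cases hbu : rank b = i + 1
          · obtain rfl := huniq b hbu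
            exact Or.inr ⟨hne, Or.inr ⟨rfl, hhole a (by omega)⟩⟩
          · left
            rw [hFadj, completed_adj]
            exact Or.inl ⟨hne, by omega, by omega, by omega⟩
      · left
        rw [hFadj]
        exact Or.inr ⟨hp, ha, hb⟩

theorem multipartite_not_isChordal (h : t < m) (ht : 1 ≤ t) : ¬ IsChordal (multipartite m t) := by
  intro hc
  obtain ⟨v, w, hvw, hv, hw⟩ := exists_ne_rank_eq (m := m) (by omega)
  obtain ⟨a, ha⟩ := exists_rank_eq (m := m) (by omega) (r := 0) (by omega)
  obtain ⟨b, hb⟩ := exists_rank_eq (m := m) (by omega) (r := 1) (by omega)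
  have hab : a ≠ b := fun h => by rw [h] at ha; omega
  refine hc _ (isHole_of_square (a := a) (b := v) (c := b) (d := w) ?_ ?_ ?_ ?_ hab hvw ?_ ?_) <;>
    rw [multipartite_adj] <;> omega

/-- `G - laterPart m t 0` is chordal, so every hole of `G` meets `laterPart m t 0`. -/
theorem multipartite_isHoleCover (h : t < m) (ht : 1 ≤ t) :
    IsHoleCover (multipartite m t) (laterPart m t 0) := by
  obtain ⟨b, hb⟩ := exists_rank_eq (m := m) (by omega) (r := 1) (by omega)
  refine ⟨⟨b, show _ ∧ _ by omega⟩, fun S hS => ?_⟩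
  by_contra hno
  have hnot : ∀ v ∈ S, v ∉ laterPart m t 0 := fun v hv hv' => hno ⟨v, hv, hv'⟩
  obtain ⟨n, hn, f, rfl⟩ := hS
  refine completed_isChordal h 0 (Set.range f) ⟨n, hn, ⟨f.toEmbedding, fun {a b} => ?_⟩, rfl⟩
  rw [← f.map_adj_iff (v := a) (w := b), ← chainStar_multipartite h (Nat.zero_le t), chainStar,
    del_adj]
  exact ⟨fun h => h.1, fun h => ⟨h, hnot _ ⟨a, rfl⟩, hnot _ ⟨b, rfl⟩⟩⟩

theorem multipartite_isLocalChordalizationPartition (h : t < m) (ht : 1 ≤ t) :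
    IsLocalChordalizationPartition (multipartite m t) (laterPart m t 0) (stepPart m) t where
  isHoleCover := multipartite_isHoleCover h ht
  pos := ht
  nonempty i hi := by
    rw [stepPart_eq (hi.2.trans_lt h)]
    exact Finset.singleton_nonempty _
  disjoint i hi j hj hij := by
    rw [Finset.disjoint_left]
    intro v hv hv'
    rw [mem_stepPart (hi.2.trans_lt h)] at hv
    rw [mem_stepPart (hj.2.trans_lt h)] at hv'
    omega
  union := iUnion_stepPart h 0
  part_isHoleCover i hi := by
    obtain ⟨i, rfl⟩ := Nat.exists_eq_add_one.2 (show 0 < i from hi.1)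
    have him : i + 1 < m := hi.2.trans_lt h
    refine ⟨by simp [stepPart_eq him], fun S hS => ?_⟩
    obtain ⟨u, hu, hr⟩ := mem_of_isHole_chain h
      (chainStar_multipartite h ((Nat.le_succ i).trans hi.2)) hS
    exact ⟨u, hu, (mem_stepPart him).2 hr⟩
  part_nc i hi := by
    obtain ⟨i, rfl⟩ := Nat.exists_eq_add_one.2 (show 0 < i from hi.1)
    have him : i + 1 < m := hi.2.trans_lt h
    rw [stepPart_eq him]
    refine ⟨fun u hu S T _ hT _ huT => ?_, fun S _ =>
      (by simp : ((({Sum.inl ⟨i + 1, him⟩} : Finset (Vert m)) : Set (Vert m)).Subsingleton)).anti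
        Set.inter_subset_right⟩
    obtain ⟨v, hv, hr⟩ := mem_of_isHole_chain h
      (chainStar_multipartite h ((Nat.le_succ i).trans hi.2)) hT
    rw [← mem_stepPart him, stepPart_eq him] at hr
    rw [Finset.mem_coe, Finset.mem_singleton] at hu
    rw [Finset.mem_singleton] at hr
    exact absurd (hu ▸ hr ▸ hv) huT
  star_chordal i hi := by
    rw [chainStar_multipartite h hi.2]
    exact completed_isChordal h i

theorem multipartite_nonChordalityIndex (h : t < m) :
    nonChordalityIndex (multipartite m t) = (t : ℕ∞) := by
  classical
  rcases Nat.eq_zero_or_pos t with rfl | ht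
  · rw [nonChordalityIndex, if_pos (multipartite_isChordal m), Nat.cast_zero]
  rw [nonChordalityIndex, if_neg (multipartite_not_isChordal h ht)]
  refine le_antisymm
    (iInf₂_le _ ⟨_, _, multipartite_isLocalChordalizationPartition h ht⟩) (le_iInf₂ ?_)
  rintro k ⟨C, P, hP⟩
  rw [Nat.cast_le]
  let A : Finset (Vert m) := Finset.univ.filter fun v => rank v ≤ t
  let B : Finset (Vert m) := Finset.univ.filter fun v => rank v = m
  have hAt : t + 1 ≤ A.card := by
    choose g hg using fun j : Fin (t + 1) =>
      exists_rank_eq (m := m) (by omega) (r := j) (by omega)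
    have := Finset.card_le_card_of_injOn (s := Finset.univ) (t := A) g
      (fun j _ => by simp [A, hg]; omega)
      (fun i _ j _ hij => Fin.ext (by rw [← hg i, ← hg j, hij]))
    simpa using this
  have hBt : t + 1 ≤ B.card := by
    have : m ≤ B.card := by
      have := Finset.card_le_card_of_injOn (s := (Finset.univ : Finset (Fin m))) (t := B)
        (fun j => Sum.inr fun _ => j) (fun j _ => by simp [B])
        (fun i _ j _ hij => congrFun (Sum.inr.inj hij) i)
      simpa using this
    omega
  refine hP.le_length multipartite_isCompleteMultipartite multipartite_atMostTwoBigParts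
    (A := A) (B := B) ?_ ?_ ?_ hAt hBt <;>
  · intro a ha b hb
    simp only [A, B, Finset.mem_filter, Finset.mem_univ, true_and] at ha hb
    rw [multipartite_adj]
    omega

end

end NonChordality

theorem mainTheorem5 (s t : ℕ) (hs : 1 ≤ s) :
    ∃ (V : Type) (_ : Fintype V) (G : SimpleGraph V),
      G.IsCompleteMultipartite ∧
      G.chromaticNumber = ((s + 1 : ℕ) : ℕ∞) ∧
      G.cliqueNum = s + 1 ∧
      NonChordality.nonChordalityIndex G = (t : ℕ∞) ∧
      NonChordality.listChromaticNumber G = ((s + t + 1 : ℕ) : ℕ∞) ∧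
      NonChordality.listChromaticNumber G =
        (G.cliqueNum : ℕ∞) + NonChordality.nonChordalityIndex G := by
  have h : t < s + t := by omega
  -- The graph `multipartite m t` with `m = s + t` has `m - t + 1 = s + 1` parts.
  obtain ⟨hχ, hω⟩ := NonChordality.multipartite_chromaticNumber_cliqueNum h
  have hi := NonChordality.multipartite_nonChordalityIndex h
  have hl := NonChordality.multipartite_listChromaticNumber h
  rw [Nat.add_sub_cancel] at hχ hω
  refine ⟨NonChordality.Vert (s + t), inferInstance, NonChordality.multipartite (s + t) t,
    NonChordality.multipartite_isCompleteMultipartite, hχ, hω, hi, hl, ?_⟩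
  rw [hl, hω, hi]
  norm_cast
  omega
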